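/- Let $\mathcal M_0$ be the set of $3\times 3$ real positive definite matrices $\Sigma=(\sigma_{ij})$ with $\sigma_{12}=0$ (that is, $X_1\perp X_2$ when $(X_1,X_2,X_3)\sim N(0,\Sigma)$), and $\mathcal M_1$ the set of those with $\sigma_{12}\sigma_{33}=\sigma_{13}\sigma_{23}$ (that is, $X_1\perp X_2\mid X_3$). Write $P_\Sigma=N(0,\Sigma)$ and let $P_\Sigma^{n}$ be the law of $n$ independent observations from $P_\Sigma$. Let $\Sigma^{(0)}_k\in\mathcal M_0\setminus\mathcal M_1$, $k=0,1,2,\dots$, be a sequence converging to a positive definite matrix, and let $\rho_{13},\rho_{23}$ (depending on $k$) be the correlations $\rho_{ij}=\sigma_{ij}/\sqrt{\sigma_{ii}\sigma_{jj}}$ of $\Sigma^{(0)}_k$. Then, for each $k$, there is exactly one minimizer $\Sigma^{(1)}_k$ of $\mathrm{KL}(P_{\Sigma^{(0)}_k}\,\|\,P_{\Sigma})$ over $\Sigma\in\mathcal M_1$; it has the same entries as $\Sigma^{(0)}_k$ except that its $(1,2)$ and $(2,1)$ entries are $\sigma_{13}\sigma_{23}/\sigma_{33}=\rho_{13}\rho_{23}\sqrt{\sigma_{11}\sigma_{22}}$.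 For this closest pair, as $k\to\infty$, $$H^2\bigl(P_{\Sigma^{(0)}_k},P_{\Sigma^{(1)}_k}\bigr)\asymp \rho_{13}^2\rho_{23}^2,\qquad H^2(P,Q)=\tfrac12\int(\sqrt p-\sqrt q)^2\,d\mu .$$ Moreover, let $(n_k)$ be any sequence of sample sizes (for instance $n_k=k$), and let $e_k$ be the optimal total error of testing $P^{n_k}_{\Sigma^{(0)}_k}$ against $P^{n_k}_{\Sigma^{(1)}_k}$, i.e. the infimum over all (possibly randomized) tests of the sum of the type-I and type-II error probabilities. Then: 1. consistent model selection is possible, i.e. there are (nonrandomized, measurable) decision rules, choosing between the two models from $n_k$ observations, whose probabilities of a wrong choice under $P^{n_k}_{\Sigma^{(0)}_k}$ and under $P^{n_k}_{\Sigma^{(1)}_k}$ both tend to $0$, if and only if $n_k=\omega\bigl(1/(\rho_{13}^2\rho_{23}^2)\bigr)$; the same condition is necessary and sufficient for $e_k\to0$; 2. the asymptotic optimal total error is strictly between $0$ and $1$, i.e. $0<\liminf_k e_k\le\limsup_k e_k<1$, if and only if $n_k\asymp 1/(\rho_{13}^2\rho_{23}^2)$. Here $a_k=\omega(b_k)$ means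 $b_k/a_k\to0$, and $a_k\asymp b_k$ means $a_k=O(b_k)$ and $b_k=O(a_k)$. -/

import Mathlib

open MeasureTheory ProbabilityTheory Filter Topology Asymptotics
open scoped ENNReal

noncomputable section

namespace MarginalVsConditional

/-- Real `3 × 3` matrices; `X₁, X₂, X₃` correspond to the indices `0, 1, 2`. -/
abbrev Mat3 : Type := Matrix (Fin 3) (Fin 3) ℝ

/-- The model `X₁ ⟂ X₂`: positive definite covariances with `σ₁₂ = 0`. -/
def model0 : Set Mat3 := {S | S.PosDef ∧ S 0 1 = 0}

/-- The model `X₁ ⟂ X₂ | X₃`: positive definite covariances with `σ₁₂ σ₃₃ = σ₁₃ σ₂₃`. -/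
def model1 : Set Mat3 := {S | S.PosDef ∧ S 0 1 * S 2 2 = S 0 2 * S 1 2}

/-- The correlation `ρᵢⱼ = σᵢⱼ / √(σᵢᵢ σⱼⱼ)`. -/
def corr (S : Mat3) (i j : Fin 3) : ℝ := S i j / √(S i i * S j j)

/-- The law `N(0, S)` on `ℝ³`. -/
def gaussianLaw (S : Mat3) : Measure (EuclideanSpace ℝ (Fin 3)) := multivariateGaussian 0 S

/-- The law of `n` independent observations from `N(0, S)`. -/
def sampleLaw (S : Mat3) (n : ℕ) : Measure (Fin n → EuclideanSpace ℝ (Fin 3)) :=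
  Measure.pi fun _ => gaussianLaw S

/-- `T` is a Kullback-Leibler projection of `S` to the model `M`: it minimizes
`KL(N(0, S) ‖ N(0, T))` over `T ∈ M`. -/
def IsKLProjection (M : Set Mat3) (S T : Mat3) : Prop :=
  T ∈ M ∧ ∀ T' ∈ M, InformationTheory.klDiv (gaussianLaw S) (gaussianLaw T) ≤
    InformationTheory.klDiv (gaussianLaw S) (gaussianLaw T')

/-- The matrix with the entries of `S`, except that `σ₁₂` is replaced by `σ₁₃ σ₂₃ / σ₃₃`, that is, by
`ρ₁₃ ρ₂₃ √(σ₁₁ σ₂₂)`. -/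
def closestCov (S : Mat3) : Mat3 :=
  !![S 0 0, S 0 2 * S 1 2 / S 2 2, S 0 2;
     S 0 2 * S 1 2 / S 2 2, S 1 1, S 1 2;
     S 0 2, S 1 2, S 2 2]

/-- The squared Hellinger distance `(1/2) ∫ (√p - √q)² dμ`, with `p, q` the densities of `P, Q`
with respect to a measure `μ` that dominates both of them. -/
def hellingerSq {X : Type*} [MeasurableSpace X] (μ P Q : Measure X) : ℝ :=
  (1 / 2) * ∫ x, (√(P.rnDeriv μ x).toReal - √(Q.rnDeriv μ x).toReal) ^ 2 ∂μ

/-- Randomized tests: `φ x` is the probability of rejecting the null hypothesis at the data `x`. -/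
def IsTest {X : Type*} [MeasurableSpace X] (φ : X → ℝ) : Prop :=
  Measurable φ ∧ ∀ x, 0 ≤ φ x ∧ φ x ≤ 1

/-- The optimal total error of testing `P` versus `Q`: the infimum over all tests of the sum of the
type-I error (under `P`) and the type-II error (under `Q`). -/
def optimalTotalError {X : Type*} [MeasurableSpace X] (P Q : Measure X) : ℝ :=
  ⨅ φ : {φ : X → ℝ // IsTest φ}, (∫ x, φ.1 x ∂P) + ∫ x, (1 - φ.1 x) ∂Q

/-- Consistent selection between two sequences of laws: some sequence of decision rules, choosing
`Q k` on the measurable set `A k` and `P k` on its complement, has both probabilities of a wrong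
choice tending to zero. -/
def ConsistentSelection {X : ℕ → Type*} [∀ k, MeasurableSpace (X k)]
    (P Q : ∀ k, Measure (X k)) : Prop :=
  ∃ A : ∀ k, Set (X k), (∀ k, MeasurableSet (A k)) ∧
    Tendsto (fun k => P k (A k)) atTop (𝓝 0) ∧ Tendsto (fun k => Q k (A k)ᶜ) atTop (𝓝 0)

end MarginalVsConditional

end

namespace MarginalVsConditional

/-! ### Densities of product measures -/

/-! Everything is governed by the Hellinger affinity `b = ∫ √(p q)` of the two Gaussian densities,
which satisfies `H² = 1 - b` and becomes `b ^ n` for `n` independent observations. Le Cam's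
inequalities `e ≤ b ^ n` and `b ^ (2 * n) ≤ e * (2 - e)` (`optimalTotalError_sampleLaw`) then reduce
all claims about the optimal error `e` to the size of `1 - b`.

The closest law is found by a Pythagorean identity. The model `X₁ ⟂ X₂ | X₃` says that the precision
matrix `T⁻¹` vanishes at the pair (1,2), so `tr (T⁻¹ S)` does not see `σ₁₂`. Replacing `σ₁₂` by the
value that puts `S` into the model therefore splits `KL(S ‖ T)` into `KL(S ‖ closestCov S) +
KL(closestCov S ‖ T)` (`klDiv_gaussianLaw_eq_add`).

For this pair put `a = corrDet S` and `h = ρ₁₃² ρ₂₃²`. The closed form of the affinity becomes `b ^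
4 * (a + 3h/4) ^ 2 = a * (a + h)` (`gaussianAffinity_closestCov`), so `1 - b ≍ h` as long as `a`
stays away from `0`, which the positive definite limit guarantees. Hence `b ^ n` lies between two
exponentials `exp (-const * n * h)`: the error vanishes iff `n h → ∞`, and it stays inside `(0, 1)`
iff `n h` is bounded above and away from `0`. -/

lemma pi_withDensity_ofReal {ι : Type*} [Fintype ι] {X : ι → Type*} [∀ i, MeasurableSpace (X i)]
    (μ : ∀ i, Measure (X i)) [∀ i, SigmaFinite (μ i)] {f : ∀ i, X i → ℝ}
    (hint : ∀ i, Integrable (f i) (μ i)) (hf : ∀ i x, 0 ≤ f i x) :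
    Measure.pi (fun i => (μ i).withDensity fun x => ENNReal.ofReal (f i x)) =
      (Measure.pi μ).withDensity fun x => ENNReal.ofReal (∏ i, f i (x i)) := by
  have (i : ι) : IsFiniteMeasure ((μ i).withDensity fun x => ENNReal.ofReal (f i x)) :=
    isFiniteMeasure_withDensity_ofReal (hint i).2
  refine Measure.pi_eq fun s hs => ?_
  rw [withDensity_apply _ (MeasurableSet.univ_pi hs), Measure.restrict_pi_pi,
    ← ofReal_integral_eq_lintegral_ofReal
      (Integrable.fintype_prod_dep fun i => (hint i).restrict)
      (ae_of_all _ fun x => Finset.prod_nonneg fun i _ => hf i _),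
    integral_fintype_prod_eq_prod,
    ENNReal.ofReal_prod_of_nonneg fun i _ => integral_nonneg (hf i)]
  refine Finset.prod_congr rfl fun i _ => ?_
  rw [withDensity_apply _ (hs i), ofReal_integral_eq_lintegral_ofReal (hint i).restrict
    (ae_of_all _ (hf i))]

/-! ### The density of a centred Gaussian law -/

section GaussianDensity

open Matrix WithLp
open scoped RealInnerProductSpace MatrixOrder

variable {ι : Type*} [Fintype ι]

/-- The Lebesgue density of the centred Gaussian law with covariance matrix `S`. -/
noncomputable def gaussianDensity [DecidableEq ι] (S : Matrix ι ι ℝ) (x : EuclideanSpace ℝ ι) : ℝ :=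
  (√((2 * Real.pi) ^ Fintype.card ι * S.det))⁻¹ *
    Real.exp (-(ofLp x ⬝ᵥ S⁻¹ *ᵥ ofLp x) / 2)

variable [DecidableEq ι] {S T : Matrix ι ι ℝ}

lemma gaussianDensity_pos (hS : S.PosDef) (x : EuclideanSpace ℝ ι) : 0 < gaussianDensity S x := by
  have := hS.det_pos
  unfold gaussianDensity
  positivity

lemma continuous_gaussianDensity (S : Matrix ι ι ℝ) : Continuous (gaussianDensity S) := by
  unfold gaussianDensity dotProduct mulVec dotProduct
  fun_prop

lemma stdGaussian_eq_withDensity :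
    stdGaussian (EuclideanSpace ℝ ι) =
      volume.withDensity fun x => ENNReal.ofReal (gaussianDensity (1 : Matrix ι ι ℝ) x) := by
  have h1 : gaussianReal 0 1 = volume.withDensity
      fun x => ENNReal.ofReal (gaussianPDFReal 0 1 x) :=
    gaussianReal_of_var_ne_zero 0 one_ne_zero
  rw [← map_pi_eq_stdGaussian, h1, pi_withDensity_ofReal _
    (fun _ => integrable_gaussianPDFReal 0 1) (fun _ => gaussianPDFReal_nonneg 0 1),
    ← volume_pi]
  have hmp := PiLp.volume_preserving_toLp ι
  refine Measure.ext fun s hs => ?_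
  rw [Measure.map_apply hmp.measurable hs, withDensity_apply _ (hmp.measurable hs),
    withDensity_apply _ hs, ← hmp.setLIntegral_comp_preimage hs
      (continuous_gaussianDensity _).measurable.ennreal_ofReal]
  refine setLIntegral_congr_fun (hmp.measurable hs) fun x _ => ?_
  congr 1
  simp only [gaussianPDFReal, gaussianDensity, Finset.prod_mul_distrib, ← Real.exp_sum]
  congr 1
  · simp [Real.sqrt_eq_rpow, ← Real.rpow_natCast, ← Real.rpow_mul, Real.pi_nonneg, mul_comm]
  · simp [dotProduct, Finset.sum_div, neg_div, sq]

/-- Change of variables: the law is the image of the standard Gaussian under `R = √S`, whose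
Jacobian is `|det R| = √(det S)`. -/
theorem multivariateGaussian_zero_eq_withDensity (hS : S.PosDef) :
    multivariateGaussian 0 S =
      volume.withDensity fun x => ENNReal.ofReal (gaussianDensity S x) := by
  set R := CFC.sqrt S
  have hRR : R * R = S := CFC.sqrt_mul_sqrt_self _ hS.posSemidef.nonneg
  have hdet : R.det * R.det = S.det := by rw [← det_mul, hRR]
  have hdet0 : R.det ≠ 0 := fun h => hS.det_pos.ne' (by rw [← hdet, h, zero_mul])
  have hRu : IsUnit R.det := isUnit_iff_ne_zero.2 hdet0
  have hRt : Rᵀ = R := by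
    simpa using (CFC.sqrt_nonneg S).posSemidef.isHermitian.eq
  set L : EuclideanSpace ℝ ι →L[ℝ] EuclideanSpace ℝ ι := toEuclideanCLM (𝕜 := ℝ) R
  have hLdet : LinearMap.det (L : EuclideanSpace ℝ ι →ₗ[ℝ] EuclideanSpace ℝ ι) = R.det := by
    simp only [L, coe_toEuclideanCLM_eq_toEuclideanLin]
    rw [toEuclideanLin_eq_toLin_orthonormal, LinearMap.det_toLin]
  have hvol := Measure.map_linearMap_addHaar_eq_smul_addHaar
    (volume : Measure (EuclideanSpace ℝ ι)) (hLdet ▸ hdet0)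
  have hLm : Measurable L := L.continuous.measurable
  have hd : ∀ x, gaussianDensity (1 : Matrix ι ι ℝ) x = |R.det| * gaussianDensity S (L x) := by
    intro x
    have hq : ofLp (L x) ⬝ᵥ S⁻¹ *ᵥ ofLp (L x) = ofLp x ⬝ᵥ ofLp x := by
      simp only [L, ofLp_toEuclideanCLM]
      rw [← hRR, Matrix.mul_inv_rev, mulVec_mulVec, mul_assoc, nonsing_inv_mul _ hRu, mul_one,
        dotProduct_mulVec, vecMul_mulVec, hRt, mul_nonsing_inv _ hRu]
      simp
    unfold gaussianDensity
    rw [hq, ← hdet, Real.sqrt_mul (by positivity) (R.det * R.det), Real.sqrt_mul_self_eq_abs]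
    have := abs_pos.2 hdet0
    simp
    field_simp
  rw [multivariateGaussian, stdGaussian_eq_withDensity]
  simp only [zero_add]
  refine Measure.ext fun s hs => ?_
  have hmeas := (continuous_gaussianDensity S).measurable.ennreal_ofReal
  have hv : Measure.map L volume = ENNReal.ofReal |R.det⁻¹| • volume := by
    rw [← hLdet, ← hvol]; rfl
  rw [Measure.map_apply hLm hs, withDensity_apply _ (hLm hs), withDensity_apply _ hs]
  have := setLIntegral_map (μ := volume) hs hmeas hLm
  simp_rw [hd, ENNReal.ofReal_mul (abs_nonneg _)]
  rw [lintegral_const_mul (f := fun x => ENNReal.ofReal (gaussianDensity S (L x))) _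
      (hmeas.comp hLm), ← this, hv, Measure.restrict_smul,
    lintegral_smul_measure, smul_eq_mul, ← mul_assoc, ← ENNReal.ofReal_mul (abs_nonneg _),
    ← abs_mul, mul_inv_cancel₀ hdet0]
  simp

end GaussianDensity

/-! ### Integrals against Gaussian densities -/

section GaussianIntegrals

open Matrix WithLp
open scoped RealInnerProductSpace MatrixOrder

variable {ι : Type*} [Fintype ι] [DecidableEq ι] {S T : Matrix ι ι ℝ}

lemma lintegral_gaussianDensity (hS : S.PosDef) :
    ∫⁻ x, ENNReal.ofReal (gaussianDensity S x) = 1 := by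
  have h : multivariateGaussian 0 S Set.univ = 1 := measure_univ
  rwa [multivariateGaussian_zero_eq_withDensity hS, withDensity_apply _ .univ,
    Measure.restrict_univ] at h

lemma integrable_gaussianDensity (hS : S.PosDef) : Integrable (gaussianDensity S) := by
  refine ⟨(continuous_gaussianDensity S).aestronglyMeasurable, ?_⟩
  rw [hasFiniteIntegral_iff_ofReal (ae_of_all _ fun x => (gaussianDensity_pos hS x).le),
    lintegral_gaussianDensity hS]
  exact ENNReal.one_lt_top

lemma integral_gaussianDensity (hS : S.PosDef) : ∫ x, gaussianDensity S x = 1 := by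
  rw [integral_eq_lintegral_of_nonneg_ae (ae_of_all _ fun x => (gaussianDensity_pos hS x).le)
    (continuous_gaussianDensity S).aestronglyMeasurable, lintegral_gaussianDensity hS]
  rfl

/-! ### The Hellinger affinity of two Gaussian laws -/

omit [Fintype ι] [DecidableEq ι] in
lemma posDef_half_add (hS : S.PosDef) (hT : T.PosDef) : ((1 / 2 : ℝ) • (S + T)).PosDef :=
  (hS.add hT).smul (by norm_num)

/-- Follows from `S * ½(S⁻¹ + T⁻¹) * T = ½(S + T)`; it removes the inverses from the normalising
constant of the geometric mean of two densities. -/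
lemma det_half_inv_add_inv (hS : S.PosDef) (hT : T.PosDef) :
    ((1 / 2 : ℝ) • (S⁻¹ + T⁻¹)).det * (S.det * T.det) = ((1 / 2 : ℝ) • (S + T)).det := by
  have hSu := hS.det_pos.ne'.isUnit
  have hTu := hT.det_pos.ne'.isUnit
  have h : S * ((1 / 2 : ℝ) • (S⁻¹ + T⁻¹)) * T = (1 / 2 : ℝ) • (S + T) := by
    rw [mul_smul_comm, smul_mul_assoc, mul_add, mul_nonsing_inv _ hSu, add_mul, one_mul,
      mul_assoc, nonsing_inv_mul _ hTu, mul_one, add_comm]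
  rw [← h, det_mul, det_mul]
  ring

/-- The geometric mean of two Gaussian densities is proportional to the Gaussian density whose
precision matrix is the average `K` of the two. The factor `c` will be the affinity; its fourth
power is free of roots. -/
lemma exists_sqrt_gaussianDensity_mul (hS : S.PosDef) (hT : T.PosDef) :
    ∃ c > 0, c ^ 4 * ((1 / 2 : ℝ) • (S + T)).det ^ 2 = S.det * T.det ∧ ∃ U : Matrix ι ι ℝ,
      U.PosDef ∧ ∀ x, √(gaussianDensity S x * gaussianDensity T x) = c * gaussianDensity U x := by
  set K := (1 / 2 : ℝ) • (S⁻¹ + T⁻¹) with hK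
  have hKp : K.PosDef := posDef_half_add hS.inv hT.inv
  have hdK := det_half_inv_add_inv hS hT
  rw [← hK] at hdK
  have hS0 := hS.det_pos
  have hT0 := hT.det_pos
  have hK0 := hKp.det_pos
  have hU0 := hKp.inv.det_pos
  have hUK : K⁻¹.det * K.det = 1 := by
    rw [← det_mul, nonsing_inv_mul _ hK0.ne'.isUnit, det_one]
  set p : ℝ := (2 * Real.pi) ^ Fintype.card ι with hp
  have hp0 : 0 < p := by positivity
  -- `c` is the geometric mean of the two normalising constants, divided by that of `U = K⁻¹`.
  refine ⟨√(√(p * S.det)⁻¹ * √(p * T.det)⁻¹) * √(p * K⁻¹.det), by positivity, ?_, K⁻¹, hKp.inv,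
    fun x => ?_⟩
  · have e1 : (√(√(p * S.det)⁻¹ * √(p * T.det)⁻¹) * √(p * K⁻¹.det)) ^ 4 =
        (√(√(p * S.det)⁻¹ * √(p * T.det)⁻¹) ^ 2) ^ 2 * (√(p * K⁻¹.det) ^ 2) ^ 2 := by ring
    rw [e1, Real.sq_sqrt (by positivity), Real.sq_sqrt (by positivity), mul_pow,
      Real.sq_sqrt (by positivity), Real.sq_sqrt (by positivity), ← hdK,
      eq_inv_of_mul_eq_one_left hUK]
    field_simp
  · rw [Real.sqrt_eq_iff_mul_self_eq (mul_pos (gaussianDensity_pos hS x)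
      (gaussianDensity_pos hT x)).le (by have := gaussianDensity_pos hKp.inv x; positivity)]
    unfold gaussianDensity
    rw [nonsing_inv_nonsing_inv _ hK0.ne'.isUnit, ← hp]
    have hq : ofLp x ⬝ᵥ K *ᵥ ofLp x =
        (ofLp x ⬝ᵥ S⁻¹ *ᵥ ofLp x + ofLp x ⬝ᵥ T⁻¹ *ᵥ ofLp x) / 2 := by
      rw [hK, smul_mulVec, add_mulVec, dotProduct_smul, dotProduct_add, smul_eq_mul]
      ring
    set s := ofLp x ⬝ᵥ S⁻¹ *ᵥ ofLp x
    set t := ofLp x ⬝ᵥ T⁻¹ *ᵥ ofLp x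
    have h1 : Real.exp (-(ofLp x ⬝ᵥ K *ᵥ ofLp x) / 2) * Real.exp (-(ofLp x ⬝ᵥ K *ᵥ ofLp x) / 2) =
        Real.exp (-s / 2) * Real.exp (-t / 2) := by
      rw [← Real.exp_add, ← Real.exp_add, hq]
      ring_nf
    have h2 : √(√(p * S.det)⁻¹ * √(p * T.det)⁻¹) * √(√(p * S.det)⁻¹ * √(p * T.det)⁻¹) =
        (√(p * S.det))⁻¹ * (√(p * T.det))⁻¹ := by
      rw [Real.mul_self_sqrt (by positivity), Real.sqrt_inv, Real.sqrt_inv]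
    have h3 : √(p * K⁻¹.det) * (√(p * K⁻¹.det))⁻¹ = 1 := mul_inv_cancel₀ (by positivity)
    linear_combination -(√(√(p * S.det)⁻¹ * √(p * T.det)⁻¹) * √(√(p * S.det)⁻¹ * √(p * T.det)⁻¹)) *
      (√(p * K⁻¹.det) * (√(p * K⁻¹.det))⁻¹) * (√(p * K⁻¹.det) * (√(p * K⁻¹.det))⁻¹) * h1 -
      Real.exp (-s / 2) * Real.exp (-t / 2) *
      (√(p * K⁻¹.det) * (√(p * K⁻¹.det))⁻¹) * (√(p * K⁻¹.det) * (√(p * K⁻¹.det))⁻¹) * h2 -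
      Real.exp (-s / 2) * Real.exp (-t / 2) * ((√(p * S.det))⁻¹ * (√(p * T.det))⁻¹) *
      (√(p * K⁻¹.det) * (√(p * K⁻¹.det))⁻¹ + 1) * h3

/-- The Hellinger affinity of `N(0, S)` and `N(0, T)`. -/
noncomputable def gaussianAffinity (S T : Matrix ι ι ℝ) : ℝ :=
  ∫ x, √(gaussianDensity S x * gaussianDensity T x)

lemma integrable_sqrt_gaussianDensity_mul (hS : S.PosDef) (hT : T.PosDef) :
    Integrable fun x => √(gaussianDensity S x * gaussianDensity T x) := by
  obtain ⟨c, -, -, U, hU, h⟩ := exists_sqrt_gaussianDensity_mul hS hT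
  simp_rw [h]
  exact (integrable_gaussianDensity hU).const_mul c

lemma gaussianAffinity_pos_and_pow_four (hS : S.PosDef) (hT : T.PosDef) :
    0 < gaussianAffinity S T ∧
      gaussianAffinity S T ^ 4 * ((1 / 2 : ℝ) • (S + T)).det ^ 2 = S.det * T.det := by
  obtain ⟨c, hc, hdet, U, hU, h⟩ := exists_sqrt_gaussianDensity_mul hS hT
  have : gaussianAffinity S T = c := by
    unfold gaussianAffinity
    simp_rw [h]
    rw [integral_const_mul, integral_gaussianDensity hU, mul_one]
  rw [this]
  exact ⟨hc, hdet⟩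

/-! ### The Kullback-Leibler divergence of two Gaussian laws -/

lemma memLp_eval_multivariateGaussian (i : ι) :
    MemLp (fun x : EuclideanSpace ℝ ι => x i) 2 (multivariateGaussian 0 S) :=
  IsGaussian.memLp_two_id.continuousLinearMap_comp (EuclideanSpace.proj (𝕜 := ℝ) i)

lemma integral_eval_mul_eval_multivariateGaussian (hS : S.PosSemidef) (i j : ι) :
    ∫ x, x i * x j ∂(multivariateGaussian 0 S) = S i j := by
  have hmean (i : ι) : ∫ x, x i ∂(multivariateGaussian 0 S) = 0 := by
    have := (EuclideanSpace.proj (𝕜 := ℝ) i).integral_comp_comm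
      (IsGaussian.integrable_fun_id (μ := multivariateGaussian 0 S))
    simpa using this
  have h := covariance_eval_multivariateGaussian (μ := 0) hS i j
  rw [covariance_eq_sub (memLp_eval_multivariateGaussian i)
    (memLp_eval_multivariateGaussian j), hmean, zero_mul, sub_zero] at h
  exact h

lemma integrable_eval_mul_eval_multivariateGaussian (i j : ι) :
    Integrable (fun x : EuclideanSpace ℝ ι => x i * x j) (multivariateGaussian 0 S) :=
  (memLp_eval_multivariateGaussian i).integrable_mul (memLp_eval_multivariateGaussian j)

omit [DecidableEq ι] in
lemma dotProduct_mulVec_eq_sum (K : Matrix ι ι ℝ) (x : ι → ℝ) :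
    x ⬝ᵥ K *ᵥ x = ∑ i, ∑ j, K i j * (x i * x j) := by
  simp only [dotProduct, mulVec, Finset.mul_sum]
  exact Finset.sum_congr rfl fun i _ => Finset.sum_congr rfl fun j _ => by ring

lemma integrable_quadratic_multivariateGaussian (K : Matrix ι ι ℝ) :
    Integrable (fun x : EuclideanSpace ℝ ι => ofLp x ⬝ᵥ K *ᵥ ofLp x)
      (multivariateGaussian 0 S) := by
  simp_rw [dotProduct_mulVec_eq_sum]
  exact integrable_finsetSum _ fun i _ => integrable_finsetSum _ fun j _ =>
    (integrable_eval_mul_eval_multivariateGaussian i j).const_mul _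

lemma integral_quadratic_multivariateGaussian (hS : S.PosSemidef) (K : Matrix ι ι ℝ) :
    ∫ x, ofLp x ⬝ᵥ K *ᵥ ofLp x ∂(multivariateGaussian 0 S) = (K * S).trace := by
  have hsymm (i j : ι) : S j i = S i j := by simpa using hS.isHermitian.apply i j
  simp_rw [dotProduct_mulVec_eq_sum]
  rw [integral_finsetSum _ fun i _ => integrable_finsetSum _ fun j _ =>
    (integrable_eval_mul_eval_multivariateGaussian i j).const_mul (K i j)]
  simp only [trace, diag, Matrix.mul_apply]
  refine Finset.sum_congr rfl fun i _ => ?_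
  rw [integral_finsetSum _ fun j _ =>
    (integrable_eval_mul_eval_multivariateGaussian i j).const_mul (K i j)]
  refine Finset.sum_congr rfl fun j _ => ?_
  rw [integral_const_mul, integral_eval_mul_eval_multivariateGaussian hS, hsymm]

lemma multivariateGaussian_eq_withDensity_div (hS : S.PosDef) (hT : T.PosDef) :
    multivariateGaussian 0 S = (multivariateGaussian 0 T).withDensity
      fun x => ENNReal.ofReal (gaussianDensity S x / gaussianDensity T x) := by
  have hm := fun U : Matrix ι ι ℝ => (continuous_gaussianDensity U).measurable
  have hST : Measurable fun x => gaussianDensity S x / gaussianDensity T x := (hm S).div (hm T)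
  rw [multivariateGaussian_zero_eq_withDensity hS, multivariateGaussian_zero_eq_withDensity hT,
    ← withDensity_mul _ (hm T).ennreal_ofReal hST.ennreal_ofReal]
  congr 1
  ext x
  rw [Pi.mul_apply, ← ENNReal.ofReal_mul (gaussianDensity_pos hT x).le,
    mul_div_cancel₀ _ (gaussianDensity_pos hT x).ne']

lemma llr_multivariateGaussian (hS : S.PosDef) (hT : T.PosDef) :
    llr (multivariateGaussian 0 S) (multivariateGaussian 0 T)
      =ᵐ[multivariateGaussian 0 S] fun x => (Real.log T.det - Real.log S.det) / 2 +
        (1 / 2) * (ofLp x ⬝ᵥ T⁻¹ *ᵥ ofLp x) - (1 / 2) * (ofLp x ⬝ᵥ S⁻¹ *ᵥ ofLp x) := by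
  have hm := fun U : Matrix ι ι ℝ => (continuous_gaussianDensity U).measurable
  have hwd := multivariateGaussian_eq_withDensity_div hS hT
  have hac : multivariateGaussian 0 S ≪ multivariateGaussian 0 T := by
    rw [hwd]; exact withDensity_absolutelyContinuous _ _
  have hrn := Measure.rnDeriv_withDensity (multivariateGaussian 0 T)
    ((hm S).div (hm T)).ennreal_ofReal
  simp only [Pi.div_apply] at hrn
  rw [← hwd] at hrn
  filter_upwards [hac.ae_le hrn] with x hx
  have hfS := gaussianDensity_pos hS x
  have hfT := gaussianDensity_pos hT x
  have hS0 := hS.det_pos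
  have hT0 := hT.det_pos
  have hp : 0 < (2 * Real.pi) ^ Fintype.card ι := by positivity
  have hlog {U : Matrix ι ι ℝ} (hU : U.PosDef) : Real.log (gaussianDensity U x) =
      -(Real.log ((2 * Real.pi) ^ Fintype.card ι) + Real.log U.det) / 2
        - (1 / 2) * (ofLp x ⬝ᵥ U⁻¹ *ᵥ ofLp x) := by
    have hU0 := hU.det_pos
    unfold gaussianDensity
    rw [Real.log_mul (by positivity) (Real.exp_pos _).ne', Real.log_exp, Real.log_inv,
      Real.log_sqrt (by positivity), Real.log_mul hp.ne' hU0.ne']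
    ring
  rw [llr, hx, ENNReal.toReal_ofReal (by positivity), Real.log_div hfS.ne' hfT.ne', hlog hS,
    hlog hT]
  ring

/-- The Kullback-Leibler divergence of `N(0, S)` from `N(0, T)`, in closed form. -/
theorem klDiv_multivariateGaussian (hS : S.PosDef) (hT : T.PosDef) :
    InformationTheory.klDiv (multivariateGaussian 0 S) (multivariateGaussian 0 T) ≠ ∞ ∧
    (InformationTheory.klDiv (multivariateGaussian 0 S) (multivariateGaussian 0 T)).toReal =
      (Real.log T.det - Real.log S.det + (T⁻¹ * S).trace - Fintype.card ι) / 2 := by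
  have hac : multivariateGaussian 0 S ≪ multivariateGaussian 0 T := by
    rw [multivariateGaussian_eq_withDensity_div hS hT]
    exact withDensity_absolutelyContinuous _ _
  have hllr := llr_multivariateGaussian hS hT
  have hq := fun K : Matrix ι ι ℝ => integrable_quadratic_multivariateGaussian (S := S) K
  have h1 : Integrable (fun x : EuclideanSpace ℝ ι => (Real.log T.det - Real.log S.det) / 2 +
      (1 / 2) * (ofLp x ⬝ᵥ T⁻¹ *ᵥ ofLp x)) (multivariateGaussian 0 S) :=
    (integrable_const _).add ((hq _).const_mul _)
  have hint : Integrable (llr (multivariateGaussian 0 S) (multivariateGaussian 0 T))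
      (multivariateGaussian 0 S) :=
    (h1.sub ((hq _).const_mul _)).congr hllr.symm
  refine ⟨InformationTheory.klDiv_ne_top hac hint, ?_⟩
  rw [InformationTheory.toReal_klDiv_of_measure_eq hac (by simp), integral_congr_ae hllr,
    integral_sub h1 ((hq _).const_mul _), integral_add (integrable_const _) ((hq _).const_mul _),
    integral_const_mul, integral_const_mul,
    integral_quadratic_multivariateGaussian hS.posSemidef,
    integral_quadratic_multivariateGaussian hS.posSemidef,
    nonsing_inv_mul _ hS.det_pos.ne'.isUnit, trace_one]
  simp
  ring

/-- The second moments recover the matrix. This turns equality of laws into uniqueness of the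
projection. -/
lemma multivariateGaussian_zero_injective (hS : S.PosSemidef) (hT : T.PosSemidef)
    (h : multivariateGaussian 0 S = multivariateGaussian 0 T) : S = T := by
  ext i j
  rw [← integral_eval_mul_eval_multivariateGaussian hS, h,
    integral_eval_mul_eval_multivariateGaussian hT]

end GaussianIntegrals

/-! ### Total error, Hellinger affinity and consistent selection -/

section Testing

variable {X : Type*} [MeasurableSpace X]

lemma IsTest.integrable {φ : X → ℝ} (hφ : IsTest φ) (P : Measure X) [IsFiniteMeasure P] :
    Integrable φ P :=
  .of_bound hφ.1.aestronglyMeasurable 1 (ae_of_all _ fun x => by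
    rw [Real.norm_eq_abs, abs_of_nonneg (hφ.2 x).1]; exact (hφ.2 x).2)

lemma IsTest.one_sub {φ : X → ℝ} (hφ : IsTest φ) : IsTest fun x => 1 - φ x :=
  ⟨hφ.1.const_sub 1, fun x => ⟨by linarith [(hφ.2 x).2], by linarith [(hφ.2 x).1]⟩⟩

lemma isTest_indicator {A : Set X} (hA : MeasurableSet A) :
    IsTest (A.indicator fun _ => (1 : ℝ)) := by
  refine ⟨measurable_const.indicator hA, fun x => ?_⟩
  by_cases hx : x ∈ A <;> simp [hx]

lemma IsTest.totalError_nonneg {φ : X → ℝ} (hφ : IsTest φ) (P Q : Measure X) :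
    0 ≤ (∫ x, φ x ∂P) + ∫ x, (1 - φ x) ∂Q :=
  add_nonneg (integral_nonneg fun x => (hφ.2 x).1) (integral_nonneg fun x => (hφ.one_sub.2 x).1)

lemma optimalTotalError_nonneg (P Q : Measure X) : 0 ≤ optimalTotalError P Q :=
  Real.iInf_nonneg fun φ => φ.2.totalError_nonneg P Q

lemma optimalTotalError_le {φ : X → ℝ} (hφ : IsTest φ) (P Q : Measure X) :
    optimalTotalError P Q ≤ (∫ x, φ x ∂P) + ∫ x, (1 - φ x) ∂Q :=
  ciInf_le (f := fun φ : {φ : X → ℝ // IsTest φ} => (∫ x, φ.1 x ∂P) + ∫ x, (1 - φ.1 x) ∂Q)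
    ⟨0, by rintro _ ⟨φ, rfl⟩; exact φ.2.totalError_nonneg P Q⟩ ⟨φ, hφ⟩

lemma exists_isTest_lt {P Q : Measure X} {a : ℝ} (h : optimalTotalError P Q < a) :
    ∃ φ : X → ℝ, IsTest φ ∧ (∫ x, φ x ∂P) + ∫ x, (1 - φ x) ∂Q < a := by
  have : Nonempty {φ : X → ℝ // IsTest φ} := ⟨⟨_, isTest_indicator MeasurableSet.empty⟩⟩
  obtain ⟨φ, hφ⟩ := exists_lt_of_ciInf_lt h
  exact ⟨φ.1, φ.2, hφ⟩

lemma optimalTotalError_le_one (P Q : Measure X) [IsProbabilityMeasure Q] :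
    optimalTotalError P Q ≤ 1 := by
  simpa using optimalTotalError_le (isTest_indicator MeasurableSet.empty) P Q

lemma optimalTotalError_le_measure {P Q : Measure X} {A : Set X} (hA : MeasurableSet A) :
    optimalTotalError P Q ≤ P.real A + Q.real Aᶜ := by
  refine (optimalTotalError_le (isTest_indicator hA) P Q).trans_eq ?_
  have h : (fun x => 1 - A.indicator (fun _ => (1 : ℝ)) x) = Aᶜ.indicator fun _ => 1 := by
    ext x; by_cases hx : x ∈ A <;> simp [hx]
  rw [h, integral_indicator hA, integral_indicator hA.compl]
  simp

/-- A randomized test is rounded to a decision rule at the threshold `1/2`; by Markov's inequality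
each error at most doubles relative to the total error of the test. -/
lemma consistentSelection_iff {X : ℕ → Type*} [∀ k, MeasurableSpace (X k)]
    (P Q : ∀ k, Measure (X k)) [∀ k, IsProbabilityMeasure (P k)]
    [∀ k, IsProbabilityMeasure (Q k)] :
    ConsistentSelection P Q ↔
      Tendsto (fun k => optimalTotalError (P k) (Q k)) atTop (𝓝 0) := by
  constructor
  · rintro ⟨A, hA, hP, hQ⟩
    have hP' := (ENNReal.tendsto_toReal ENNReal.zero_ne_top).comp hP
    have hQ' := (ENNReal.tendsto_toReal ENNReal.zero_ne_top).comp hQ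
    have h := hP'.add hQ'
    simp only [ENNReal.toReal_zero, add_zero] at h
    exact squeeze_zero (fun k => optimalTotalError_nonneg _ _)
      (fun k => optimalTotalError_le_measure (hA k)) h
  · intro h
    -- Near-optimal tests suffice, with slack `1 / (k + 1)`, so attainment of the infimum is not
    -- needed.
    have hlt (k : ℕ) : optimalTotalError (P k) (Q k) <
        optimalTotalError (P k) (Q k) + 1 / ((k : ℝ) + 1) := by
      have : 0 < 1 / ((k : ℝ) + 1) := by positivity
      linarith
    choose φ hφ hφlt using fun k => exists_isTest_lt (hlt k)
    have hlim := (h.add tendsto_one_div_add_atTop_nhds_zero_nat).const_mul 2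
    simp only [add_zero, mul_zero] at hlim
    refine ⟨fun k => {x | 1 / 2 ≤ φ k x},
      fun k => measurableSet_le measurable_const (hφ k).1, ?_, ?_⟩
    · have hb (k : ℕ) : (P k).real {x | 1 / 2 ≤ φ k x} ≤
          2 * (optimalTotalError (P k) (Q k) + 1 / ((k : ℝ) + 1)) := by
        have := mul_meas_ge_le_integral_of_nonneg (μ := P k)
          (ae_of_all _ fun x => ((hφ k).2 x).1) ((hφ k).integrable _) (1 / 2)
        have h2 : 0 ≤ ∫ x, (1 - φ k x) ∂(Q k) := integral_nonneg fun x => ((hφ k).one_sub.2 x).1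
        linarith [hφlt k]
      have := squeeze_zero (fun k => measureReal_nonneg) hb hlim
      simpa [Measure.real] using (ENNReal.tendsto_toReal_iff (fun k => measure_ne_top _ _)
        ENNReal.zero_ne_top).1 (by simpa [Measure.real] using this)
    · have hb (k : ℕ) : (Q k).real {x | 1 / 2 ≤ φ k x}ᶜ ≤
          2 * (optimalTotalError (P k) (Q k) + 1 / ((k : ℝ) + 1)) := by
        have := mul_meas_ge_le_integral_of_nonneg (μ := Q k)
          (ae_of_all _ fun x => ((hφ k).one_sub.2 x).1) ((hφ k).one_sub.integrable _) (1 / 2)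
        have h2 : 0 ≤ ∫ x, φ k x ∂(P k) := integral_nonneg fun x => ((hφ k).2 x).1
        have h3 : (Q k).real {x | 1 / 2 ≤ φ k x}ᶜ ≤ (Q k).real {x | 1 / 2 ≤ 1 - φ k x} := by
          refine measureReal_mono fun x hx => ?_
          simp only [Set.mem_compl_iff, Set.mem_ofPred_eq, not_le] at hx ⊢
          linarith
        linarith [hφlt k]
      have := squeeze_zero (fun k => measureReal_nonneg) hb hlim
      simpa [Measure.real] using (ENNReal.tendsto_toReal_iff (fun k => measure_ne_top _ _)
        ENNReal.zero_ne_top).1 (by simpa [Measure.real] using this)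

/-! ### Laws given by densities and Le Cam's inequalities -/

variable {μ : Measure X} {p q : X → ℝ}

lemma integral_withDensity_ofReal {φ : X → ℝ} (hpm : Measurable p) (hp : ∀ x, 0 ≤ p x) :
    ∫ x, φ x ∂(μ.withDensity fun x => ENNReal.ofReal (p x)) = ∫ x, p x * φ x ∂μ := by
  rw [integral_withDensity_eq_integral_toReal_smul hpm.ennreal_ofReal
    (ae_of_all _ fun x => ENNReal.ofReal_lt_top)]
  simp [ENNReal.toReal_ofReal (hp _)]

/-- The likelihood ratio test, rejecting where `p ≤ q`, has total error `∫ min p q`, and `min p q ≤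
√(p q)`. -/
lemma optimalTotalError_le_affinity (hpm : Measurable p) (hqm : Measurable q)
    (hp : ∀ x, 0 ≤ p x) (hq : ∀ x, 0 ≤ q x) (hpi : Integrable p μ) (hqi : Integrable q μ)
    (hb : Integrable (fun x => √(p x * q x)) μ) :
    optimalTotalError (μ.withDensity fun x => ENNReal.ofReal (p x))
      (μ.withDensity fun x => ENNReal.ofReal (q x)) ≤ ∫ x, √(p x * q x) ∂μ := by
  have hA : MeasurableSet {x | p x ≤ q x} := measurableSet_le hpm hqm
  have ht := isTest_indicator hA
  refine (optimalTotalError_le ht _ _).trans ?_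
  rw [integral_withDensity_ofReal hpm hp, integral_withDensity_ofReal hqm hq, ← integral_add]
  · refine integral_mono_of_nonneg (ae_of_all _ fun x => ?_) hb (ae_of_all _ fun x => ?_)
    · exact add_nonneg (mul_nonneg (hp x) (ht.2 x).1) (mul_nonneg (hq x) (ht.one_sub.2 x).1)
    · refine Real.le_sqrt_of_sq_le ?_
      by_cases hx : p x ≤ q x
      · simp [hx]; nlinarith [hp x]
      · simp [hx]; nlinarith [hq x]
  · exact hpi.mul_bdd (c := 1) ht.1.aestronglyMeasurable (ae_of_all _ fun x => by
      rw [Real.norm_eq_abs, abs_of_nonneg (ht.2 x).1]; exact (ht.2 x).2)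
  · exact hqi.mul_bdd (c := 1) ht.one_sub.1.aestronglyMeasurable (ae_of_all _ fun x => by
      rw [Real.norm_eq_abs, abs_of_nonneg (ht.one_sub.2 x).1]; exact (ht.one_sub.2 x).2)

/-- Cauchy-Schwarz for `√(p q) = √(min p q) * √(max p q)`, by the discriminant of the nonnegative
quadratic `t ↦ ∫ (√min * t - √max)²`. -/
lemma sq_affinity_le_integral_min_mul_integral_max
    (hp : ∀ x, 0 ≤ p x) (hq : ∀ x, 0 ≤ q x) (hpi : Integrable p μ) (hqi : Integrable q μ)
    (hb : Integrable (fun x => √(p x * q x)) μ) :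
    (∫ x, √(p x * q x) ∂μ) ^ 2 ≤ (∫ x, min (p x) (q x) ∂μ) * ∫ x, max (p x) (q x) ∂μ := by
  have hmin : Integrable (fun x => min (p x) (q x)) μ := hpi.inf hqi
  have hmax : Integrable (fun x => max (p x) (q x)) μ := hpi.sup hqi
  have hb' (t : ℝ) : Integrable (fun x => min (p x) (q x) * (t * t) + √(p x * q x) * (-2 * t)) μ :=
    (hmin.mul_const _).add (hb.mul_const _)
  have key (t : ℝ) : 0 ≤ (∫ x, min (p x) (q x) ∂μ) * (t * t) +
      (-2 * ∫ x, √(p x * q x) ∂μ) * t + ∫ x, max (p x) (q x) ∂μ := by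
    have h : ∫ x, (min (p x) (q x) * (t * t) + √(p x * q x) * (-2 * t) + max (p x) (q x)) ∂μ =
        (∫ x, min (p x) (q x) ∂μ) * (t * t) +
      (-2 * ∫ x, √(p x * q x) ∂μ) * t + ∫ x, max (p x) (q x) ∂μ := by
      rw [integral_add (hb' t) hmax,
        integral_add (hmin.mul_const _) (hb.mul_const _), integral_mul_const, integral_mul_const]
      ring
    rw [← h]
    refine integral_nonneg fun x => ?_
    have h1 : min (p x) (q x) = √(min (p x) (q x)) ^ 2 := (Real.sq_sqrt (le_min (hp x) (hq x))).symm
    have h2 : max (p x) (q x) = √(max (p x) (q x)) ^ 2 :=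
      (Real.sq_sqrt ((hp x).trans (le_max_left _ _))).symm
    have h3 : √(p x * q x) = √(min (p x) (q x)) * √(max (p x) (q x)) := by
      rw [← Real.sqrt_mul (le_min (hp x) (hq x)), min_mul_max]
    simp only [Pi.zero_apply]
    rw [h3]
    nlinarith [sq_nonneg (√(min (p x) (q x)) * t - √(max (p x) (q x)))]
  have := discrim_le_zero key
  rw [discrim] at this
  linarith

lemma integral_min_le_optimalTotalError (hpm : Measurable p) (hqm : Measurable q)
    (hp : ∀ x, 0 ≤ p x) (hq : ∀ x, 0 ≤ q x) (hpi : Integrable p μ) (hqi : Integrable q μ) :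
    ∫ x, min (p x) (q x) ∂μ ≤ optimalTotalError (μ.withDensity fun x => ENNReal.ofReal (p x))
      (μ.withDensity fun x => ENNReal.ofReal (q x)) := by
  have : Nonempty {φ : X → ℝ // IsTest φ} := ⟨⟨_, isTest_indicator MeasurableSet.empty⟩⟩
  refine le_ciInf fun ⟨φ, hφ⟩ => ?_
  have h1 : Integrable (fun x => p x * φ x) μ :=
    hpi.mul_bdd (c := 1) hφ.1.aestronglyMeasurable (ae_of_all _ fun x => by
      rw [Real.norm_eq_abs, abs_of_nonneg (hφ.2 x).1]; exact (hφ.2 x).2)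
  have h2 : Integrable (fun x => q x * (1 - φ x)) μ :=
    hqi.mul_bdd (c := 1) hφ.one_sub.1.aestronglyMeasurable (ae_of_all _ fun x => by
      rw [Real.norm_eq_abs, abs_of_nonneg (hφ.one_sub.2 x).1]; exact (hφ.one_sub.2 x).2)
  rw [integral_withDensity_ofReal hpm hp, integral_withDensity_ofReal hqm hq, ← integral_add h1 h2]
  refine integral_mono (hpi.inf hqi) (h1.add h2) fun x => ?_
  obtain ⟨h0, h1⟩ := hφ.2 x
  change min (p x) (q x) ≤ p x * φ x + q x * (1 - φ x)
  nlinarith [mul_le_mul_of_nonneg_right (min_le_left (p x) (q x)) h0,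
    mul_le_mul_of_nonneg_right (min_le_right (p x) (q x)) (sub_nonneg.2 h1)]

lemma sq_affinity_le_of_optimalTotalError (hpm : Measurable p) (hqm : Measurable q)
    (hp : ∀ x, 0 ≤ p x) (hq : ∀ x, 0 ≤ q x) (hpi : Integrable p μ) (hqi : Integrable q μ)
    (hb : Integrable (fun x => √(p x * q x)) μ) (hp1 : ∫ x, p x ∂μ = 1) (hq1 : ∫ x, q x ∂μ = 1)
    {e : ℝ} (he : e = optimalTotalError (μ.withDensity fun x => ENNReal.ofReal (p x))
      (μ.withDensity fun x => ENNReal.ofReal (q x))) (he1 : e ≤ 1) :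
    (∫ x, √(p x * q x) ∂μ) ^ 2 ≤ e * (2 - e) := by
  have hmin := integral_min_le_optimalTotalError hpm hqm hp hq hpi hqi
  have hmax : (∫ x, min (p x) (q x) ∂μ) + ∫ x, max (p x) (q x) ∂μ = 2 := by
    have hmin : Integrable (fun x => min (p x) (q x)) μ := hpi.inf hqi
    have hmax : Integrable (fun x => max (p x) (q x)) μ := hpi.sup hqi
    rw [← integral_add hmin hmax]
    simp_rw [min_add_max]
    rw [integral_add hpi hqi, hp1, hq1]
    norm_num
  have hsq := sq_affinity_le_integral_min_mul_integral_max hp hq hpi hqi hb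
  rw [← he] at hmin
  rw [eq_sub_of_add_eq' hmax] at hsq
  -- `m ↦ m * (2 - m)` increases on `m ≤ 1`, and `∫ min p q ≤ e ≤ 1`.
  nlinarith

lemma hellingerSq_withDensity [SigmaFinite μ] (hpm : Measurable p) (hqm : Measurable q)
    (hp : ∀ x, 0 ≤ p x) (hq : ∀ x, 0 ≤ q x) (hpi : Integrable p μ) (hqi : Integrable q μ)
    (hb : Integrable (fun x => √(p x * q x)) μ) (hp1 : ∫ x, p x ∂μ = 1) (hq1 : ∫ x, q x ∂μ = 1) :
    hellingerSq μ (μ.withDensity fun x => ENNReal.ofReal (p x))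
      (μ.withDensity fun x => ENNReal.ofReal (q x)) = 1 - ∫ x, √(p x * q x) ∂μ := by
  have h : ∀ᵐ x ∂μ,
      (√((μ.withDensity fun x => ENNReal.ofReal (p x)).rnDeriv μ x).toReal -
        √((μ.withDensity fun x => ENNReal.ofReal (q x)).rnDeriv μ x).toReal) ^ 2 =
      p x + q x - 2 * √(p x * q x) := by
    filter_upwards [Measure.rnDeriv_withDensity μ hpm.ennreal_ofReal,
      Measure.rnDeriv_withDensity μ hqm.ennreal_ofReal] with x h1 h2
    rw [h1, h2, ENNReal.toReal_ofReal (hp x), ENNReal.toReal_ofReal (hq x), sub_sq,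
      Real.sq_sqrt (hp x), Real.sq_sqrt (hq x), Real.sqrt_mul (hp x)]
    ring
  have hpq : Integrable (fun x => p x + q x) μ := hpi.add hqi
  rw [hellingerSq, integral_congr_ae h, integral_sub hpq (hb.const_mul _),
    integral_add hpi hqi, integral_const_mul, hp1, hq1]
  ring

end Testing

/-! ### Products of Gaussian laws -/

section Sample

variable {S T : Mat3}

instance (S : Mat3) : IsProbabilityMeasure (gaussianLaw S) := by
  unfold gaussianLaw; infer_instance

instance (S : Mat3) (n : ℕ) : IsProbabilityMeasure (sampleLaw S n) := by
  unfold sampleLaw; infer_instance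

lemma sampleLaw_eq_withDensity (hS : S.PosDef) (n : ℕ) :
    sampleLaw S n = (Measure.pi fun _ => volume).withDensity
      fun x : Fin n → EuclideanSpace ℝ (Fin 3) =>
        ENNReal.ofReal (∏ i, gaussianDensity S (x i)) := by
  rw [sampleLaw, gaussianLaw, multivariateGaussian_zero_eq_withDensity hS]
  exact pi_withDensity_ofReal _ (fun _ => integrable_gaussianDensity hS)
    fun _ x => (gaussianDensity_pos hS x).le

lemma sqrt_prod_mul_prod (hS : S.PosDef) (hT : T.PosDef) {n : ℕ}
    (x : Fin n → EuclideanSpace ℝ (Fin 3)) :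
    √((∏ i, gaussianDensity S (x i)) * ∏ i, gaussianDensity T (x i)) =
      ∏ i, √(gaussianDensity S (x i) * gaussianDensity T (x i)) := by
  have h (i : Fin n) := (mul_pos (gaussianDensity_pos hS (x i)) (gaussianDensity_pos hT (x i))).le
  rw [← Finset.prod_mul_distrib, Real.sqrt_prod _ fun i _ => h i]

theorem optimalTotalError_sampleLaw (hS : S.PosDef) (hT : T.PosDef) (n : ℕ) :
    optimalTotalError (sampleLaw S n) (sampleLaw T n) ≤ gaussianAffinity S T ^ n ∧
      (gaussianAffinity S T ^ n) ^ 2 ≤ optimalTotalError (sampleLaw S n) (sampleLaw T n) *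
        (2 - optimalTotalError (sampleLaw S n) (sampleLaw T n)) := by
  have hm (U : Mat3) : Measurable fun x : Fin n → EuclideanSpace ℝ (Fin 3) =>
      ∏ i, gaussianDensity U (x i) :=
    Finset.measurable_prod _ fun i _ =>
      (continuous_gaussianDensity U).measurable.comp (measurable_pi_apply i)
  have hpos {U : Mat3} (hU : U.PosDef) (x : Fin n → EuclideanSpace ℝ (Fin 3)) :
      0 ≤ ∏ i, gaussianDensity U (x i) :=
    Finset.prod_nonneg fun i _ => (gaussianDensity_pos hU _).le
  have hi {U : Mat3} (hU : U.PosDef) : Integrable (fun x : Fin n → EuclideanSpace ℝ (Fin 3) =>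
      ∏ i, gaussianDensity U (x i)) (Measure.pi fun _ => volume) :=
    Integrable.fintype_prod fun _ => integrable_gaussianDensity hU
  have h1 {U : Mat3} (hU : U.PosDef) : ∫ x : Fin n → EuclideanSpace ℝ (Fin 3),
      ∏ i, gaussianDensity U (x i) ∂(Measure.pi fun _ => volume) = 1 := by
    rw [integral_fintype_prod_eq_prod fun _ => gaussianDensity U]
    simp [integral_gaussianDensity hU]
  have hb : Integrable (fun x : Fin n → EuclideanSpace ℝ (Fin 3) =>
      √((∏ i, gaussianDensity S (x i)) * ∏ i, gaussianDensity T (x i)))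
      (Measure.pi fun _ => volume) := by
    simp_rw [sqrt_prod_mul_prod hS hT]
    exact Integrable.fintype_prod
      (f := fun _ x => √(gaussianDensity S x * gaussianDensity T x))
      fun _ => integrable_sqrt_gaussianDensity_mul hS hT
  have hbn : ∫ x : Fin n → EuclideanSpace ℝ (Fin 3),
      √((∏ i, gaussianDensity S (x i)) * ∏ i, gaussianDensity T (x i))
      ∂(Measure.pi fun _ => volume) = gaussianAffinity S T ^ n := by
    simp_rw [sqrt_prod_mul_prod hS hT]
    rw [integral_fintype_prod_eq_prod fun _ x => √(gaussianDensity S x * gaussianDensity T x)]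
    simp [gaussianAffinity]
  have he1 := optimalTotalError_le_one (sampleLaw S n) (sampleLaw T n)
  have hle := optimalTotalError_le_affinity (hm S) (hm T) (hpos hS) (hpos hT) (hi hS) (hi hT) hb
  have hsq := sq_affinity_le_of_optimalTotalError (hm S) (hm T) (hpos hS) (hpos hT) (hi hS) (hi hT)
    hb (h1 hS) (h1 hT) rfl
    (by rw [← sampleLaw_eq_withDensity hS, ← sampleLaw_eq_withDensity hT]; exact he1)
  rw [hbn, ← sampleLaw_eq_withDensity hS, ← sampleLaw_eq_withDensity hT] at hle hsq
  exact ⟨hle, hsq⟩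

lemma hellingerSq_gaussianLaw (hS : S.PosDef) (hT : T.PosDef) :
    hellingerSq volume (gaussianLaw S) (gaussianLaw T) = 1 - gaussianAffinity S T := by
  rw [gaussianLaw, gaussianLaw, multivariateGaussian_zero_eq_withDensity hS,
    multivariateGaussian_zero_eq_withDensity hT]
  exact hellingerSq_withDensity (continuous_gaussianDensity S).measurable
    (continuous_gaussianDensity T).measurable (fun x => (gaussianDensity_pos hS x).le)
    (fun x => (gaussianDensity_pos hT x).le) (integrable_gaussianDensity hS)
    (integrable_gaussianDensity hT) (integrable_sqrt_gaussianDensity_mul hS hT)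
    (integral_gaussianDensity hS) (integral_gaussianDensity hT)

end Sample

/-! ### The Kullback-Leibler projection -/

section Projection

open Matrix

variable {S T : Mat3}

lemma posDef_symm (hS : S.PosDef) (i j : Fin 3) : S j i = S i j := by
  simpa using hS.isHermitian.apply i j

lemma det_fin_three_of_posDef (hS : S.PosDef) :
    S.det = S 0 0 * S 1 1 * S 2 2 + 2 * (S 0 1 * S 0 2 * S 1 2) - S 0 0 * S 1 2 ^ 2
      - S 1 1 * S 0 2 ^ 2 - S 2 2 * S 0 1 ^ 2 := by
  rw [det_fin_three, posDef_symm hS 0 1, posDef_symm hS 0 2, posDef_symm hS 1 2]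
  ring

lemma minor_pos_of_posDef (hS : S.PosDef) {i j : Fin 3} (hij : i ≠ j) :
    0 < S i i * S j j - S i j ^ 2 := by
  have hi := hS.diag_pos (i := i)
  -- At this vector the quadratic form equals `S i i` times the minor.
  have hx : Pi.single i (S i j) - Pi.single j (S i i) ≠ (0 : Fin 3 → ℝ) := fun h => by
    have := congrFun h j
    simp [hij.symm, hi.ne'] at this
  have h := hS.dotProduct_mulVec_pos hx
  have e : star (Pi.single i (S i j) - Pi.single j (S i i) : Fin 3 → ℝ) ⬝ᵥ
      (S *ᵥ (Pi.single i (S i j) - Pi.single j (S i i))) =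
      S i i * (S i i * S j j - S i j ^ 2) := by
    simp [mulVec_sub, dotProduct_sub, sub_dotProduct, posDef_symm hS i j]
    ring
  rw [e] at h
  exact pos_of_mul_pos_right h hi.le

/-- Completing the square in `x 2` leaves no `x 0 * x 1` term, precisely because of the new `σ₁₂`;
the remaining coefficients are principal minors of `S`. -/
lemma closestCov_posDef (hS : S.PosDef) : (closestCov S).PosDef := by
  have h2 := hS.diag_pos (i := 2)
  have h02 := minor_pos_of_posDef hS (show (0 : Fin 3) ≠ 2 by decide)
  have h12 := minor_pos_of_posDef hS (show (1 : Fin 3) ≠ 2 by decide)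
  refine .of_dotProduct_mulVec_pos ?_ fun x hx => ?_
  · ext i j
    fin_cases i <;> fin_cases j <;> simp [closestCov]
  · have e : star x ⬝ᵥ (closestCov S *ᵥ x) =
        ((S 2 2 * x 2 + S 0 2 * x 0 + S 1 2 * x 1) ^ 2 + (S 0 0 * S 2 2 - S 0 2 ^ 2) * x 0 ^ 2 +
          (S 1 1 * S 2 2 - S 1 2 ^ 2) * x 1 ^ 2) / S 2 2 := by
      simp [closestCov, dotProduct, mulVec, Fin.sum_univ_three]
      field_simp
      ring
    rw [e]
    refine div_pos ?_ h2
    by_contra! hle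
    have n0 := mul_nonneg h02.le (sq_nonneg (x 0))
    have n1 := mul_nonneg h12.le (sq_nonneg (x 1))
    have n2 := sq_nonneg (S 2 2 * x 2 + S 0 2 * x 0 + S 1 2 * x 1)
    have z0 : x 0 = 0 := by
      have : (S 0 0 * S 2 2 - S 0 2 ^ 2) * x 0 ^ 2 = 0 := by linarith
      simpa [h02.ne'] using this
    have z1 : x 1 = 0 := by
      have : (S 1 1 * S 2 2 - S 1 2 ^ 2) * x 1 ^ 2 = 0 := by linarith
      simpa [h12.ne'] using this
    have z2 : x 2 = 0 := by
      have : (S 2 2 * x 2 + S 0 2 * x 0 + S 1 2 * x 1) ^ 2 = 0 := by linarith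
      simpa [z0, z1, h2.ne'] using this
    exact hx (by ext i; fin_cases i <;> assumption)

lemma closestCov_mem_model1 (hS : S.PosDef) : closestCov S ∈ model1 := by
  refine ⟨closestCov_posDef hS, ?_⟩
  have h2 := (hS.diag_pos (i := 2)).ne'
  simp [closestCov, h2]

/-- The equation defining the model is the vanishing of the (1,2) cofactor. -/
lemma inv_apply_of_mem_model1 (hT : T ∈ model1) : T⁻¹ 0 1 = 0 ∧ T⁻¹ 1 0 = 0 := by
  have h01 : T⁻¹ 0 1 = 0 := by
    rw [inv_def, Matrix.smul_apply, adjugate_fin_three]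
    have := hT.2
    simp [posDef_symm hT.1 1 2]
    right
    linarith
  exact ⟨h01, by rw [posDef_symm hT.1.inv 0 1, h01]⟩

lemma trace_inv_mul_closestCov (hS : S.PosDef) (hT : T ∈ model1) :
    (T⁻¹ * closestCov S).trace = (T⁻¹ * S).trace := by
  obtain ⟨h01, h10⟩ := inv_apply_of_mem_model1 hT
  simp [trace, Fin.sum_univ_three, Matrix.mul_apply, h01, h10, closestCov, posDef_symm hS 0 2,
    posDef_symm hS 1 2]

/-- The Pythagorean identity for the projection of `N(0, S)` to the model `X₁ ⟂ X₂ | X₃`. -/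
lemma klDiv_gaussianLaw_eq_add (hS : S.PosDef) (hT : T ∈ model1) :
    InformationTheory.klDiv (gaussianLaw S) (gaussianLaw T) =
      InformationTheory.klDiv (gaussianLaw S) (gaussianLaw (closestCov S)) +
        InformationTheory.klDiv (gaussianLaw (closestCov S)) (gaussianLaw T) := by
  have hC := closestCov_posDef hS
  obtain ⟨f1, e1⟩ := klDiv_multivariateGaussian hS hT.1
  obtain ⟨f2, e2⟩ := klDiv_multivariateGaussian hS hC
  obtain ⟨f3, e3⟩ := klDiv_multivariateGaussian hC hT.1
  unfold gaussianLaw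
  -- All divergences are finite, so the closed forms can be compared in `ℝ`. With `C = closestCov
  -- S`, the traces agree: `tr (T⁻¹ C) = tr (T⁻¹ S)` and `tr (C⁻¹ S) = tr (C⁻¹ C) = 3`.
  rw [← ENNReal.toReal_eq_toReal_iff' f1 (ENNReal.add_ne_top.2 ⟨f2, f3⟩),
    ENNReal.toReal_add f2 f3, e1, e2, e3, trace_inv_mul_closestCov hS hT,
    ← trace_inv_mul_closestCov hS (closestCov_mem_model1 hS),
    nonsing_inv_mul _ hC.det_pos.ne'.isUnit, trace_one]
  ring

theorem isKLProjection_model1_iff (hS : S.PosDef) :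
    IsKLProjection model1 S T ↔ T = closestCov S := by
  constructor
  · rintro ⟨hT, hmin⟩
    have h := hmin _ (closestCov_mem_model1 hS)
    rw [klDiv_gaussianLaw_eq_add hS hT] at h
    have h0 : InformationTheory.klDiv (gaussianLaw (closestCov S)) (gaussianLaw T) = 0 := by
      -- Finiteness of the first summand makes adding a nonzero divergence a strict increase.
      have hf := (klDiv_multivariateGaussian hS (closestCov_posDef hS)).1
      by_contra hne
      exact (ENNReal.lt_add_right hf hne).not_ge h
    rw [InformationTheory.klDiv_eq_zero_iff] at h0
    exact (multivariateGaussian_zero_injective (closestCov_posDef hS).posSemidef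
      hT.1.posSemidef h0).symm
  · rintro rfl
    refine ⟨closestCov_mem_model1 hS, fun T' hT' => ?_⟩
    rw [klDiv_gaussianLaw_eq_add hS hT']
    exact le_self_add

end Projection

/-! ### The affinity of a covariance matrix and its projection -/

section Affinity

open Matrix

variable {S : Mat3}

lemma det_closestCov (hS : S.PosDef) :
    (closestCov S).det * S 2 2 =
      (S 0 0 * S 2 2 - S 0 2 ^ 2) * (S 1 1 * S 2 2 - S 1 2 ^ 2) := by
  have h2 := (hS.diag_pos (i := 2)).ne'
  rw [det_fin_three]
  simp [closestCov]
  field_simp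
  ring

/-- Setting the (1,2) entry to `x = σ₁₃σ₂₃ / (2σ₃₃)` adds `2xσ₁₃σ₂₃ - σ₃₃x²` to `det S`: the
coefficient is `1 - 1/4 = 3/4`. -/
lemma det_half_add_closestCov (hS : S.PosDef) (h01 : S 0 1 = 0) :
    ((1 / 2 : ℝ) • (S + closestCov S)).det * (4 * S 2 2) =
      4 * S 2 2 * S.det + 3 * (S 0 2 ^ 2 * S 1 2 ^ 2) := by
  have h2 := (hS.diag_pos (i := 2)).ne'
  rw [det_fin_three_of_posDef hS, det_fin_three]
  simp [closestCov, h01, posDef_symm hS 0 1, posDef_symm hS 0 2, posDef_symm hS 1 2]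
  field_simp
  ring

lemma corr_sq (hS : S.PosDef) (i j : Fin 3) : corr S i j ^ 2 = S i j ^ 2 / (S i i * S j j) := by
  rw [corr, div_pow, Real.sq_sqrt (mul_pos hS.diag_pos hS.diag_pos).le]

lemma corr_sq_le_one (hS : S.PosDef) {i j : Fin 3} (hij : i ≠ j) : corr S i j ^ 2 ≤ 1 := by
  rw [corr_sq hS, div_le_one (mul_pos hS.diag_pos hS.diag_pos)]
  linarith [minor_pos_of_posDef hS hij]

lemma corr_sq_mul_corr_sq_pos (hS : S ∈ model0 \ model1) :
    0 < corr S 0 2 ^ 2 * corr S 1 2 ^ 2 := by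
  obtain ⟨⟨hp, h01⟩, h1⟩ := hS
  have h : S 0 2 * S 1 2 ≠ 0 := fun h => h1 ⟨hp, by rw [h01, h, zero_mul]⟩
  have h0 := hp.diag_pos (i := 0)
  have h1 := hp.diag_pos (i := 1)
  have h2 := hp.diag_pos (i := 2)
  rw [corr_sq hp, corr_sq hp]
  have := left_ne_zero_of_mul h
  have := right_ne_zero_of_mul h
  positivity

/-- The determinant of the correlation matrix. -/
noncomputable def corrDet (S : Mat3) : ℝ := S.det / (S 0 0 * S 1 1 * S 2 2)

lemma corrDet_le_one (hS : S.PosDef) (h01 : S 0 1 = 0) : corrDet S ≤ 1 := by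
  have h0 := hS.diag_pos (i := 0)
  have h1 := hS.diag_pos (i := 1)
  have h2 := hS.diag_pos (i := 2)
  rw [corrDet, div_le_one (by positivity), det_fin_three_of_posDef hS, h01]
  have : 0 ≤ S 0 0 * S 1 2 ^ 2 := by positivity
  have : 0 ≤ S 1 1 * S 0 2 ^ 2 := by positivity
  linarith

lemma gaussianAffinity_closestCov (hS : S.PosDef) (h01 : S 0 1 = 0) :
    gaussianAffinity S (closestCov S) ^ 4 *
        (corrDet S + 3 / 4 * (corr S 0 2 ^ 2 * corr S 1 2 ^ 2)) ^ 2 =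
      corrDet S * (corrDet S + corr S 0 2 ^ 2 * corr S 1 2 ^ 2) := by
  have h0 := hS.diag_pos (i := 0)
  have h1 := hS.diag_pos (i := 1)
  have h2 := hS.diag_pos (i := 2)
  have hb := (gaussianAffinity_pos_and_pow_four hS (closestCov_posDef hS)).2
  have hM := det_half_add_closestCov hS h01
  have hC := det_closestCov hS
  have hd := det_fin_three_of_posDef hS
  rw [h01] at hd
  set D := S 0 0 * S 1 1 * S 2 2 with hD
  have hD0 : 0 < D := by positivity
  have eM : corrDet S + 3 / 4 * (corr S 0 2 ^ 2 * corr S 1 2 ^ 2) =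
      ((1 / 2 : ℝ) • (S + closestCov S)).det / D := by
    rw [eq_div_of_mul_eq (by positivity) hM, corrDet, corr_sq hS, corr_sq hS, ← hD, hD]
    field_simp
  have eC : corrDet S + corr S 0 2 ^ 2 * corr S 1 2 ^ 2 = (closestCov S).det / D := by
    rw [eq_div_of_mul_eq h2.ne' hC, corrDet, corr_sq hS, corr_sq hS, ← hD, hd, hD]
    field_simp
    ring
  rw [eM, eC, corrDet, ← hD, div_pow, ← mul_div_assoc, hb]
  field_simp

/-- With `w = (a + 3h/4)²`, the identity reads `(1 - b⁴) w = ah/2 + 9h²/16`, where `a₀² ≤ w ≤ 4`.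
Since `1 - b ≤ 1 - b⁴ ≤ 4(1 - b)`, this gives the constants `a₀/32` and `2/a₀²`; the last bound
comes from `a₀² ≤ 4b⁴ ≤ 4b`. -/
lemma affinity_bounds {a₀ a h b : ℝ} (ha₀ : 0 < a₀) (haa : a₀ ≤ a) (ha : a ≤ 1) (hh : 0 < h)
    (hh1 : h ≤ 1) (hb : 0 < b) (hab : b ^ 4 * (a + 3 / 4 * h) ^ 2 = a * (a + h)) :
    a₀ / 32 * h ≤ 1 - b ∧ 1 - b ≤ 2 / a₀ ^ 2 * h ∧ a₀ ^ 2 / 4 ≤ b := by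
  have ha0 : 0 < a := ha₀.trans_le haa
  have hw : 0 < (a + 3 / 4 * h) ^ 2 := by positivity
  have hw4 : (a + 3 / 4 * h) ^ 2 ≤ 4 := by nlinarith
  have hwa : a₀ ^ 2 ≤ (a + 3 / 4 * h) ^ 2 := by
    apply pow_le_pow_left₀ ha₀.le; linarith
  have h1 : (1 - b ^ 4) * (a + 3 / 4 * h) ^ 2 = a * h / 2 + 9 * h ^ 2 / 16 := by
    rw [sub_mul, hab]; ring
  have hb4 : 0 < 1 - b ^ 4 := by
    by_contra! hle
    have := mul_nonpos_of_nonpos_of_nonneg hle hw.le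
    have : 0 < a * h / 2 + 9 * h ^ 2 / 16 := by positivity
    linarith
  have hb1 : b < 1 := lt_of_pow_lt_pow_left₀ 4 zero_le_one (by linarith)
  have hb4b : b ^ 4 ≤ b := pow_le_of_le_one hb.le hb1.le (by norm_num)
  refine ⟨?_, ?_, ?_⟩
  · have h2 : a₀ * h / 2 ≤ (1 - b ^ 4) * 4 := by
      calc a₀ * h / 2 ≤ a * h / 2 + 9 * h ^ 2 / 16 := by nlinarith
        _ = _ := h1.symm
        _ ≤ _ := mul_le_mul_of_nonneg_left hw4 hb4.le
    have h3 : 1 - b ^ 4 ≤ 4 * (1 - b) := by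
      have h4 : 1 - b ^ 4 = (1 - b) * ((1 + b) * (1 + b ^ 2)) := by ring
      have h5 : (1 + b) * (1 + b ^ 2) ≤ 4 := by 
        nlinarith [sq_nonneg b, pow_le_one₀ (n := 2) hb.le hb1.le]
      rw [h4, mul_comm 4]
      exact mul_le_mul_of_nonneg_left h5 (by linarith)
    linarith
  · have h2 : (1 - b ^ 4) * a₀ ^ 2 ≤ 2 * h := by
      calc (1 - b ^ 4) * a₀ ^ 2 ≤ (1 - b ^ 4) * (a + 3 / 4 * h) ^ 2 :=
            mul_le_mul_of_nonneg_left hwa hb4.le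
        _ = _ := h1
        _ ≤ _ := by nlinarith
    rw [div_mul_eq_mul_div, le_div_iff₀ (by positivity)]
    nlinarith [sq_nonneg a₀]
  · have h2 : a₀ ^ 2 ≤ b ^ 4 * 4 := by
      calc a₀ ^ 2 ≤ a * (a + h) := by nlinarith
        _ = _ := hab.symm
        _ ≤ _ := mul_le_mul_of_nonneg_left hw4 (by positivity)
    linarith

end Affinity

/-! ### Rates -/

section Rates

/-- The upper bound is `1 + x ≤ exp x`; the lower one is `log b ≥ 1 - 1/b`, where `β ≤ b` controls
the division by `b`. -/
lemma exp_bounds_of_affinity {b h c C β : ℝ} (hβ : 0 < β) (hb1 : b ≤ 1) (h1 : c * h ≤ 1 - b)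
    (h2 : 1 - b ≤ C * h) (h3 : β ≤ b) (n : ℕ) :
    b ^ n ≤ Real.exp (-(c * (n * h))) ∧ Real.exp (-(C / β * (n * h))) ≤ b ^ n := by
  have hb : 0 < b := hβ.trans_le h3
  constructor
  · have : b ≤ Real.exp (-(c * h)) := by
      have := Real.add_one_le_exp (-(c * h))
      linarith
    refine (pow_le_pow_left₀ hb.le this n).trans_eq ?_
    rw [← Real.exp_nat_mul]
    ring_nf
  · have h4 : 1 - b⁻¹ ≤ Real.log b := Real.one_sub_inv_le_log_of_pos hb
    have h5 : b⁻¹ - 1 ≤ C / β * h := by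
      have e : b⁻¹ - 1 = (1 - b) / b := by field_simp
      rw [e, div_mul_eq_mul_div]
      exact div_le_div₀ (by linarith) h2 hβ h3
    have : Real.exp (-(C / β * h)) ≤ b := by
      rw [← Real.le_log_iff_exp_le hb]
      linarith
    refine le_trans (Eq.le ?_) (pow_le_pow_left₀ (Real.exp_pos _).le this n)
    rw [← Real.exp_nat_mul]
    ring_nf

variable {h e : ℕ → ℝ} {n : ℕ → ℕ} {c D : ℝ}

lemma one_div_isLittleO_iff (hh : ∀ k, 0 < h k) :
    (fun k => 1 / h k) =o[atTop] (fun k => (n k : ℝ)) ↔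
      Tendsto (fun k => (n k : ℝ) * h k) atTop atTop := by
  rw [isLittleO_iff, tendsto_atTop]
  have key (ε : ℝ) (k : ℕ) : ‖1 / h k‖ ≤ ε * ‖(n k : ℝ)‖ ↔ 1 ≤ ε * (n k * h k) := by
    rw [Real.norm_of_nonneg (one_div_pos.2 (hh k)).le, Real.norm_of_nonneg (Nat.cast_nonneg _),
      div_le_iff₀ (hh k), mul_assoc]
  simp_rw [key]
  constructor
  · intro H b
    have hb : 0 < |b| + 1 := by positivity
    filter_upwards [H (inv_pos.2 hb)] with k hk
    rw [← div_eq_inv_mul, le_div_iff₀ hb] at hk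
    linarith [le_abs_self b]
  · intro H ε hε
    filter_upwards [H ε⁻¹] with k hk
    have := mul_le_mul_of_nonneg_left hk hε.le
    rwa [mul_inv_cancel₀ hε.ne'] at this

lemma isTheta_one_div_iff (hh : ∀ k, 0 < h k) :
    (fun k => (n k : ℝ)) =Θ[atTop] (fun k => 1 / h k) ↔
      ∃ A > 0, ∃ B, ∀ᶠ k in atTop, A ≤ n k * h k ∧ n k * h k ≤ B := by
  have k1 (C : ℝ) (k : ℕ) : ‖(n k : ℝ)‖ ≤ C * ‖1 / h k‖ ↔ n k * h k ≤ C := by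
    rw [Real.norm_of_nonneg (one_div_pos.2 (hh k)).le, Real.norm_of_nonneg (Nat.cast_nonneg _),
      mul_one_div, le_div_iff₀ (hh k)]
  have k2 (C : ℝ) (k : ℕ) : ‖1 / h k‖ ≤ C * ‖(n k : ℝ)‖ ↔ 1 ≤ C * (n k * h k) := by
    rw [Real.norm_of_nonneg (one_div_pos.2 (hh k)).le, Real.norm_of_nonneg (Nat.cast_nonneg _),
      div_le_iff₀ (hh k), mul_assoc]
  constructor
  · rintro ⟨h1, h2⟩
    obtain ⟨B, hB⟩ := h1.bound
    obtain ⟨A, hA0, hA⟩ := h2.exists_pos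
    refine ⟨A⁻¹, inv_pos.2 hA0, B, ?_⟩
    filter_upwards [hB, hA.bound] with k hk1 hk2
    rw [k1] at hk1
    rw [k2] at hk2
    exact ⟨(inv_le_iff_one_le_mul₀' hA0).2 hk2, hk1⟩
  · rintro ⟨A, hA, B, H⟩
    refine ⟨.of_bound B ?_, .of_bound A⁻¹ ?_⟩
    · filter_upwards [H] with k hk
      exact (k1 _ _).2 hk.2
    · filter_upwards [H] with k hk
      rw [k2, ← div_eq_inv_mul, one_le_div₀ hA]
      exact hk.1

lemma tendsto_zero_iff_of_exp_bounds (hc : 0 < c) (hD : 0 < D) {x : ℕ → ℝ} (he0 : ∀ k, 0 ≤ e k)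
    (hu : ∀ᶠ k in atTop, e k ≤ Real.exp (-(c * x k)))
    (hl : ∀ᶠ k in atTop, Real.exp (-(D * x k)) ≤ e k * (2 - e k)) :
    Tendsto e atTop (𝓝 0) ↔ Tendsto x atTop atTop := by
  constructor
  · intro h
    have h1 : Tendsto (fun k => e k * (2 - e k)) atTop (𝓝 0) := by
      simpa using h.mul (h.const_sub 2)
    have h2 : Tendsto (fun k => Real.exp (-(D * x k))) atTop (𝓝 0) :=
      squeeze_zero' (.of_forall fun k => (Real.exp_pos _).le) hl h1
    rw [Real.tendsto_exp_comp_nhds_zero, tendsto_neg_atBot_iff] at h2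
    exact (tendsto_const_mul_atTop_of_pos hD).1 h2
  · intro h
    refine squeeze_zero' (.of_forall he0) hu ?_
    rw [Real.tendsto_exp_comp_nhds_zero, tendsto_neg_atBot_iff]
    exact (tendsto_const_mul_atTop_of_pos hc).2 h

lemma liminf_pos_and_limsup_lt_one_iff (he0 : ∀ k, 0 ≤ e k) (he1 : ∀ k, e k ≤ 1) :
    (0 < liminf e atTop ∧ limsup e atTop < 1) ↔
      ∃ α > 0, ∃ β < 1, ∀ᶠ k in atTop, α ≤ e k ∧ e k ≤ β := by
  have hba : IsBoundedUnder (· ≤ ·) atTop e := isBoundedUnder_of ⟨1, he1⟩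
  have hbb : IsBoundedUnder (· ≥ ·) atTop e := isBoundedUnder_of ⟨0, he0⟩
  constructor
  · rintro ⟨h0, h1⟩
    obtain ⟨α, hα0, hα⟩ := exists_between h0
    obtain ⟨β, hβ, hβ1⟩ := exists_between h1
    refine ⟨α, hα0, β, hβ1, ?_⟩
    filter_upwards [eventually_lt_of_lt_liminf hα hbb, eventually_lt_of_limsup_lt hβ hba]
      with k h2 h3
    exact ⟨h2.le, h3.le⟩
  · rintro ⟨α, hα, β, hβ, H⟩
    exact ⟨hα.trans_le (le_liminf_of_le hba.isCoboundedUnder_ge (H.mono fun k hk => hk.1)),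
      (limsup_le_of_le hbb.isCoboundedUnder_le (H.mono fun k hk => hk.2)).trans_lt hβ⟩

lemma bounded_iff_of_exp_bounds (hc : 0 < c) (hD : 0 < D) {x : ℕ → ℝ}
    (hu : ∀ᶠ k in atTop, e k ≤ Real.exp (-(c * x k)))
    (hl : ∀ᶠ k in atTop, Real.exp (-(D * x k)) ≤ e k * (2 - e k)) :
    (∃ α > 0, ∃ β < 1, ∀ᶠ k in atTop, α ≤ e k ∧ e k ≤ β) ↔
      ∃ A > 0, ∃ B, ∀ᶠ k in atTop, A ≤ x k ∧ x k ≤ B := by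
  constructor
  · rintro ⟨α, hα, β, hβ, H⟩
    -- One index satisfying both bounds forces `β > 0`, so that the logarithm below is legitimate.
    obtain ⟨k, hk⟩ := H.exists
    have hβ0 : 0 < β := hα.trans_le (hk.1.trans hk.2)
    have hγ0 : 0 < β * (2 - β) := mul_pos hβ0 (by linarith)
    have hγ1 : β * (2 - β) < 1 := by nlinarith [mul_pos (sub_pos.2 hβ) (sub_pos.2 hβ)]
    -- Obtained by solving `exp (-(D x)) ≤ β(2 - β) < 1` and `α ≤ exp (-(c x))` for `x`.
    refine ⟨-Real.log (β * (2 - β)) / D, div_pos (neg_pos.2 (Real.log_neg hγ0 hγ1)) hD,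
      -Real.log α / c, ?_⟩
    filter_upwards [H, hu, hl] with k hk h1 h2
    constructor
    · have h3 : Real.exp (-(D * x k)) ≤ β * (2 - β) := h2.trans (by nlinarith)
      rw [← Real.le_log_iff_exp_le hγ0] at h3
      rw [div_le_iff₀ hD]
      linarith
    · have h3 : Real.log α ≤ -(c * x k) := (Real.log_le_iff_le_exp hα).2 (hk.1.trans h1)
      rw [le_div_iff₀ hc]
      linarith
  · rintro ⟨A, hA, B, H⟩
    -- The half comes from `e(2 - e) ≤ 2e`.
    refine ⟨Real.exp (-(D * B)) / 2, by positivity, Real.exp (-(c * A)), ?_, ?_⟩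
    · rw [Real.exp_lt_one_iff]
      linarith [mul_pos hc hA]
    · filter_upwards [H, hu, hl] with k hk h1 h2
      constructor
      · have h3 : Real.exp (-(D * B)) ≤ Real.exp (-(D * x k)) :=
          Real.exp_le_exp.2 (neg_le_neg (mul_le_mul_of_nonneg_left hk.2 hD.le))
        nlinarith [sq_nonneg (e k)]
      · exact h1.trans (Real.exp_le_exp.2 (neg_le_neg (mul_le_mul_of_nonneg_left hk.1 hc.le)))

end Rates

/-! ### Uniformity along the convergent sequence -/

lemma exists_corrDet_ge {S0 : ℕ → Mat3} {Slim : Mat3} (hlim : Tendsto S0 atTop (𝓝 Slim))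
    (hSlim : Slim.PosDef) : ∃ a₀ > 0, ∀ᶠ k in atTop, a₀ ≤ corrDet (S0 k) := by
  have hD : 0 < Slim 0 0 * Slim 1 1 * Slim 2 2 :=
    mul_pos (mul_pos hSlim.diag_pos hSlim.diag_pos) hSlim.diag_pos
  have hpos : 0 < corrDet Slim := div_pos hSlim.det_pos hD
  have hcoord (i j : Fin 3) : ContinuousAt (fun S : Mat3 => S i j) Slim :=
    (continuous_id.matrix_elem i j).continuousAt
  have hcont : ContinuousAt corrDet Slim :=
    continuous_id.matrix_det.continuousAt.div
      (((hcoord 0 0).mul (hcoord 1 1)).mul (hcoord 2 2)) hD.ne'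
  exact ⟨corrDet Slim / 2, half_pos hpos,
    (hcont.tendsto.comp hlim).eventually_const_le (half_lt_self hpos)⟩

/-- Uniform two-sided bounds for the affinity of `S0 k` and its projection. -/
lemma eventually_gaussianAffinity_bounds {S0 : ℕ → Mat3} {Slim : Mat3}
    (hS0 : ∀ k, S0 k ∈ model0 \ model1) (hlim : Tendsto S0 atTop (𝓝 Slim))
    (hSlim : Slim.PosDef) : ∃ c > 0, ∃ C > 0, ∃ β > 0, ∀ᶠ k in atTop,
      c * (corr (S0 k) 0 2 ^ 2 * corr (S0 k) 1 2 ^ 2) ≤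
        1 - gaussianAffinity (S0 k) (closestCov (S0 k)) ∧
      1 - gaussianAffinity (S0 k) (closestCov (S0 k)) ≤
        C * (corr (S0 k) 0 2 ^ 2 * corr (S0 k) 1 2 ^ 2) ∧
      β ≤ gaussianAffinity (S0 k) (closestCov (S0 k)) := by
  obtain ⟨a₀, ha₀, ha⟩ := exists_corrDet_ge hlim hSlim
  refine ⟨a₀ / 32, by positivity, 2 / a₀ ^ 2, by positivity, a₀ ^ 2 / 4, by positivity, ?_⟩
  filter_upwards [ha] with k hk
  have hp := (hS0 k).1.1
  have h01 := (hS0 k).1.2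
  exact affinity_bounds ha₀ hk (corrDet_le_one hp h01) (corr_sq_mul_corr_sq_pos (hS0 k))
    (mul_le_one₀ (corr_sq_le_one hp (by decide)) (sq_nonneg _) (corr_sq_le_one hp (by decide)))
    (gaussianAffinity_pos_and_pow_four hp (closestCov_posDef hp)).1
    (gaussianAffinity_closestCov hp h01)

end MarginalVsConditional

open MarginalVsConditional in
theorem mainTheorem9
    (S0 : ℕ → Matrix (Fin 3) (Fin 3) ℝ) (Slim : Matrix (Fin 3) (Fin 3) ℝ)
    (hS0 : ∀ k, S0 k ∈ model0 \ model1)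
    (hlim : Tendsto S0 atTop (𝓝 Slim)) (hSlim : Slim.PosDef) :
    -- the closest element of the other model exists, is unique, and has the explicit form
    (∀ k T, IsKLProjection model1 (S0 k) T ↔ T = closestCov (S0 k)) ∧
    ∀ S1 : ℕ → Matrix (Fin 3) (Fin 3) ℝ, (∀ k, IsKLProjection model1 (S0 k) (S1 k)) →
      (fun k => hellingerSq volume (gaussianLaw (S0 k)) (gaussianLaw (S1 k))) =Θ[atTop]
        (fun k => corr (S0 k) 0 2 ^ 2 * corr (S0 k) 1 2 ^ 2) ∧
      ∀ n : ℕ → ℕ,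
        (ConsistentSelection (fun k => sampleLaw (S0 k) (n k)) (fun k => sampleLaw (S1 k) (n k)) ↔
          (fun k => 1 / (corr (S0 k) 0 2 ^ 2 * corr (S0 k) 1 2 ^ 2)) =o[atTop]
            fun k => (n k : ℝ)) ∧
        (Tendsto (fun k => optimalTotalError (sampleLaw (S0 k) (n k)) (sampleLaw (S1 k) (n k)))
            atTop (𝓝 0) ↔
          (fun k => 1 / (corr (S0 k) 0 2 ^ 2 * corr (S0 k) 1 2 ^ 2)) =o[atTop]
            fun k => (n k : ℝ)) ∧
        ((0 < liminf (fun k =>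
              optimalTotalError (sampleLaw (S0 k) (n k)) (sampleLaw (S1 k) (n k))) atTop ∧
            limsup (fun k =>
              optimalTotalError (sampleLaw (S0 k) (n k)) (sampleLaw (S1 k) (n k))) atTop < 1) ↔
          (fun k => (n k : ℝ)) =Θ[atTop]
            fun k => 1 / (corr (S0 k) 0 2 ^ 2 * corr (S0 k) 1 2 ^ 2)) := by
  have hp (k : ℕ) : (S0 k).PosDef := (hS0 k).1.1
  refine ⟨fun k T => isKLProjection_model1_iff (hp k), fun S1 hS1 => ?_⟩
  obtain rfl : S1 = fun k => closestCov (S0 k) :=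
    funext fun k => (isKLProjection_model1_iff (hp k)).1 (hS1 k)
  have hh (k : ℕ) := corr_sq_mul_corr_sq_pos (hS0 k)
  obtain ⟨c, hc, C, hC, β, hβ, hbd⟩ := eventually_gaussianAffinity_bounds hS0 hlim hSlim
  set h : ℕ → ℝ := fun k => corr (S0 k) 0 2 ^ 2 * corr (S0 k) 1 2 ^ 2
  refine ⟨⟨.of_bound C ?_, .of_bound c⁻¹ ?_⟩, fun n => ?_⟩
  · filter_upwards [hbd] with k ⟨h1, h2, _⟩
    rw [hellingerSq_gaussianLaw (hp k) (closestCov_posDef (hp k)), Real.norm_of_nonneg (hh k).le,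
      Real.norm_of_nonneg ((mul_pos hc (hh k)).le.trans h1)]
    exact h2
  · filter_upwards [hbd] with k ⟨h1, h2, _⟩
    rw [hellingerSq_gaussianLaw (hp k) (closestCov_posDef (hp k)), Real.norm_of_nonneg (hh k).le,
      Real.norm_of_nonneg ((mul_pos hc (hh k)).le.trans h1), ← div_eq_inv_mul, le_div_iff₀' hc]
    exact h1
  set e : ℕ → ℝ := fun k =>
    optimalTotalError (sampleLaw (S0 k) (n k)) (sampleLaw (closestCov (S0 k)) (n k))
  have he0 (k : ℕ) : 0 ≤ e k := optimalTotalError_nonneg _ _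
  have he1 (k : ℕ) : e k ≤ 1 := optimalTotalError_le_one _ _
  -- The factor `2` appears because Le Cam's lower bound involves the squared affinity.
  have hD : 0 < 2 * (C / β) := by positivity
  have hu : ∀ᶠ k in atTop, e k ≤ Real.exp (-(c * (n k * h k))) := by
    filter_upwards [hbd] with k ⟨h1, h2, h3⟩
    exact (optimalTotalError_sampleLaw (hp k) (closestCov_posDef (hp k)) (n k)).1.trans
      (exp_bounds_of_affinity hβ (by linarith [mul_pos hc (hh k)]) h1 h2 h3 (n k)).1
  have hl : ∀ᶠ k in atTop, Real.exp (-(2 * (C / β) * (n k * h k))) ≤ e k * (2 - e k) := by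
    filter_upwards [hbd] with k ⟨h1, h2, h3⟩
    refine le_trans ?_ (optimalTotalError_sampleLaw (hp k) (closestCov_posDef (hp k)) (n k)).2
    refine le_trans (Eq.le ?_) (pow_le_pow_left₀ (Real.exp_pos _).le
      (exp_bounds_of_affinity hβ (by linarith [mul_pos hc (hh k)]) h1 h2 h3 (n k)).2 2)
    rw [← Real.exp_nat_mul]
    congr 1
    push_cast
    ring
  have hzero := (tendsto_zero_iff_of_exp_bounds hc hD he0 hu hl).trans
    (one_div_isLittleO_iff hh).symm
  exact ⟨(consistentSelection_iff _ _).trans hzero, hzero,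
    (liminf_pos_and_limsup_lt_one_iff he0 he1).trans
      ((bounded_iff_of_exp_bounds hc hD hu hl).trans (isTheta_one_div_iff hh).symm)⟩
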